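/- Let $G$ be a finite soluble group acting faithfully and transitively on a set $\Omega$ (that is, a finite soluble transitive permutation group on $\Omega$), and suppose that $G$ acts with fixity $2$, meaning that every non-identity element of $G$ fixes at most $2$ points of $\Omega$ and some non-identity element fixes exactly $2$ points. Then at least one of the following holds. (1) $G$ has a normal subgroup that acts regularly on $\Omega$ (i.e. transitively with trivial point stabilizers). (2) $G$ has a normal subgroup $F$ of index $2$ that has exactly two orbits on $\Omega$, these have equal length, and $F$ acts as a Frobenius group on each of them. (Here $F$ acts as a Frobenius group on a set $X$ if the action is faithful and transitive, some non-identity element of $F$ fixes a point of $X$, and every non-identity element of $F$ fixes at most one point of $X$.) (3) $|\Omega| = 6$, and $G \cong \mathrm{Alt}_4$ or $G \cong \mathrm{Sym}_4$. -/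

import Mathlib

/-- A group `G` has fixity `k` on `Ω` if `k` is the maximum of the numbers of points of `Ω`
fixed by the non-identity elements of `G`. -/
def HasFixity (G Ω : Type*) [Group G] [MulAction G Ω] (k : ℕ) : Prop :=
  IsGreatest {n : ℕ∞ | ∃ g : G, g ≠ 1 ∧ n = (MulAction.fixedBy Ω g).encard} (k : ℕ∞)

/-- The action of `H` on `X` is regular: transitive with trivial point stabilizers. -/
structure IsRegularAction (H X : Type*) [Group H] [MulAction H X] : Prop where
  transitive : MulAction.IsPretransitive H X
  stabilizer_eq_bot : ∀ x : X, MulAction.stabilizer H x = ⊥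

/-- `F` acts on `X` as a Frobenius group: the action is faithful and transitive, some point
stabilizer is non-trivial, and every non-identity element fixes at most one point. -/
structure IsFrobeniusAction (F X : Type*) [Group F] [MulAction F X] : Prop where
  faithful : FaithfulSMul F X
  transitive : MulAction.IsPretransitive F X
  exists_stabilizer_ne_bot : ∃ x : X, MulAction.stabilizer F x ≠ ⊥
  fixedBy_subsingleton : ∀ g : F, g ≠ 1 → (MulAction.fixedBy X g).Subsingleton

open MulAction

/-! Take a maximal semiregular normal subgroup `N` and count its orbits. If `g` lies outside `N`,
every point of a `g`-invariant `N`-orbit is fixed by exactly one element of the coset `N g`, and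
each of these elements fixes at most two points. So `g` fixes at most two `N`-orbits, and if it
fixes two then every element of `N g` fixes a point (`exists_card_mul_card_le` and its two
consequences).

One orbit: `N` is regular.

Two orbits: let `F` be the kernel of the action on them. If some `h ≠ 1` fixed two points of one
orbit, `h` would be an involution inverting `N`, and the squares in `N` would form a subgroup `K` of
index two with four orbits. The elements of `G` acting on these as the identity or a double
transposition would form a larger semiregular normal subgroup
(`exists_semiregular_of_fixes_two_in_orbit`). So `F` is Frobenius on both orbits.

At least three orbits: only here is solubility needed. It gives a normal `M > N` with `M/N` abelian,
and `M` is not semiregular. Commutativity forces the `M`-orbits on the `N`-orbits to be pairs, and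
maximality makes every element of `M` fix a point. Then `N = 1` and `M` is a Klein four-group with
three pairs of points, as in the rotations of an octahedron about its axes. Finally `G` acts
faithfully on its four Sylow 3-subgroups. -/

/-- The subgroup `N` acts semiregularly on `Ω`: only the identity of `N` fixes a point. -/
def Subgroup.ActsSemiregularly {G : Type*} [Group G] (N : Subgroup G) (Ω : Type*)
    [MulAction G Ω] : Prop :=
  ∀ n ∈ N, ∀ ω : Ω, n • ω = ω → n = 1

/-- The permutation induced by `g` has at most two fixed points. -/
def FixesAtMostTwo {G : Type*} [Group G] (g : G) (Ω : Type*) [MulAction G Ω] : Prop :=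
  ∀ a b c : Ω, g • a = a → g • b = b → g • c = c → a = b ∨ a = c ∨ b = c

/-- A group acts on the set of orbits of a normal subgroup. -/
instance MulAction.orbitRel.Quotient.normalMulAction {G Ω : Type*} [Group G] [MulAction G Ω]
    (N : Subgroup G) [hN : N.Normal] : MulAction G (orbitRel.Quotient N Ω) where
  smul g := Quotient.map (g • ·) (by
    rintro a b ⟨n, rfl⟩
    refine ⟨⟨g * n * g⁻¹, hN.conj_mem n n.2 g⟩, ?_⟩
    change (g * n * g⁻¹) • g • b = g • (n : G) • b
    simp [mul_smul])
  one_smul x := by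
    induction x using Quotient.inductionOn with
    | h a => exact congrArg _ (one_smul G a)
  mul_smul g h x := by
    induction x using Quotient.inductionOn with
    | h a => exact congrArg _ (mul_smul g h a)

/-! ### Orbits of a semiregular normal subgroup and the counting argument -/

section Orbits

variable {G Ω : Type*} [Group G] [MulAction G Ω] (N : Subgroup G) [hN : N.Normal]

/-- The orbit of a point under a normal subgroup, as a point of the set of orbits. -/
def orbitMk (a : Ω) : orbitRel.Quotient N Ω := Quotient.mk'' a

omit hN in
theorem orbitMk_surjective : Function.Surjective (orbitMk N : Ω → _) :=
  Quotient.mk''_surjective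

theorem smul_orbitMk (g : G) (a : Ω) : g • orbitMk N a = orbitMk N (g • a) := rfl

omit hN in
theorem orbitMk_eq_iff {a b : Ω} : orbitMk N a = orbitMk N b ↔ ∃ n ∈ N, n • b = a := by
  refine Quotient.eq''.trans ?_
  constructor
  · rintro ⟨n, hn⟩
    exact ⟨n, n.2, hn⟩
  · rintro ⟨n, hn, h⟩
    exact ⟨⟨n, hn⟩, h⟩

theorem smul_orbitRelQuotient_of_mem {n : G} (hn : n ∈ N) (x : orbitRel.Quotient N Ω) :
    n • x = x := by
  obtain ⟨a, rfl⟩ := orbitMk_surjective N x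
  rw [smul_orbitMk, orbitMk_eq_iff]
  exact ⟨n, hn, rfl⟩

instance orbitRelQuotient_isPretransitive [IsPretransitive G Ω] :
    IsPretransitive G (orbitRel.Quotient N Ω) where
  exists_smul_eq x y := by
    obtain ⟨a, rfl⟩ := orbitMk_surjective N x
    obtain ⟨b, rfl⟩ := orbitMk_surjective N y
    obtain ⟨g, rfl⟩ := exists_smul_eq G a b
    exact ⟨g, smul_orbitMk N g a⟩

variable {N}

omit hN in
theorem Subgroup.ActsSemiregularly.eq_of_smul_eq (hs : N.ActsSemiregularly Ω) {m n : G}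
    (hm : m ∈ N) (hn : n ∈ N) {a : Ω} (h : m • a = n • a) : m = n := by
  have := hs (n⁻¹ * m) (N.mul_mem (N.inv_mem hn) hm) a (by rw [mul_smul, h, inv_smul_smul])
  exact (inv_mul_eq_one.mp this).symm

/-- Representatives of distinct orbits of `N` fixed by `g` give rise to many pairs `(n, ω)`
such that `n * g` fixes `ω`. -/
theorem exists_card_mul_card_le [Finite G] (hs : N.ActsSemiregularly Ω) {ι : Type*} [Fintype ι]
    (w : ι → Ω) (hw : Function.Injective fun i => orbitMk N (w i)) {g : G}
    (hg : ∀ n ∈ N, FixesAtMostTwo (n * g) Ω) (hgw : ∀ i, g • orbitMk N (w i) = orbitMk N (w i)) :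
    ∃ s : Finset N, (∀ n ∈ s, ∃ ω : Ω, ((n : G) * g) • ω = ω) ∧
      Fintype.card ι * Nat.card N ≤ 2 * s.card := by
  classical
  have := Fintype.ofFinite N
  have hex : ∀ i, ∃ a ∈ N, a • w i = g • w i := fun i => by
    have := hgw i
    rwa [smul_orbitMk, orbitMk_eq_iff] at this
  choose a ha haw using hex
  -- `φ (i, m)` is the `n` in `N` for which `n * g` fixes the point `m • w i`. Its fibres have at
  -- most two elements because `n * g` has at most two fixed points.
  let φ : ι × N → N := fun p =>
    ⟨p.2 * (a p.1)⁻¹ * (g * (p.2 : G)⁻¹ * g⁻¹), N.mul_mem (N.mul_mem p.2.2 (N.inv_mem (ha p.1)))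
      (hN.conj_mem _ (N.inv_mem p.2.2) g)⟩
  have hφ : ∀ p : ι × N, ((φ p : G) * g) • ((p.2 : G) • w p.1) = (p.2 : G) • w p.1 := fun p => by
    have : ((φ p : G) * g) • ((p.2 : G) • w p.1) = (p.2 * (a p.1)⁻¹ : G) • g • w p.1 := by
      simp only [φ, smul_smul]
      group
    rw [this, ← haw, mul_smul, inv_smul_smul]
  have hinj : ∀ p q : ι × N, (p.2 : G) • w p.1 = (q.2 : G) • w q.1 → p = q := by
    rintro ⟨i, m⟩ ⟨j, n⟩ h
    have hij : i = j := hw (by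
      have := congrArg (orbitMk N) h
      rwa [← smul_orbitMk, ← smul_orbitMk, smul_orbitRelQuotient_of_mem N m.2,
        smul_orbitRelQuotient_of_mem N n.2] at this)
    subst hij
    exact Prod.ext rfl (Subtype.ext (hs.eq_of_smul_eq m.2 n.2 h))
  refine ⟨Finset.univ.image φ, ?_, ?_⟩
  · intro n hn
    obtain ⟨p, -, rfl⟩ := Finset.mem_image.mp hn
    exact ⟨_, hφ p⟩
  · have := Finset.card_le_mul_card_image (f := φ) Finset.univ 2 (by
      intro n _
      by_contra! hlt
      obtain ⟨p, hp, q, hq, r, hr, hpq, hpr, hqr⟩ := Finset.two_lt_card.mp hlt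
      simp only [Finset.mem_filter, Finset.mem_univ, true_and] at hp hq hr
      rcases hg n n.2 _ _ _ (hp ▸ hφ p) (hq ▸ hφ q) (hr ▸ hφ r) with h | h | h
      · exact hpq (hinj _ _ h)
      · exact hpr (hinj _ _ h)
      · exact hqr (hinj _ _ h))
    simpa [Fintype.card_prod, Nat.card_eq_fintype_card] using this

variable (hfix : ∀ g : G, g ≠ 1 → FixesAtMostTwo g Ω)

include hfix

omit hN in
theorem fixesAtMostTwo_mul_of_notMem {g : G} (hg : g ∉ N) :
    ∀ n ∈ N, FixesAtMostTwo (n * g) Ω := fun n hn => hfix _ fun h =>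
  hg (by rw [← (N.mul_mem_cancel_left hn), h]; exact N.one_mem)

/-- The bound on the number of fixed points passes to the set of orbits of a semiregular
normal subgroup. -/
theorem fixesAtMostTwo_orbitRelQuotient [Finite G] (hs : N.ActsSemiregularly Ω) {g : G}
    (hg : g ∉ N) : FixesAtMostTwo g (orbitRel.Quotient N Ω) := by
  have := Fintype.ofFinite N
  intro x y z hx hy hz
  by_contra! hne
  obtain ⟨a, rfl⟩ := orbitMk_surjective N x
  obtain ⟨b, rfl⟩ := orbitMk_surjective N y
  obtain ⟨c, rfl⟩ := orbitMk_surjective N z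
  obtain ⟨s, -, hcard⟩ := exists_card_mul_card_le hs ![a, b, c] (by
    intro i j
    fin_cases i <;> fin_cases j <;> simp [hne, hne.1.symm, hne.2.1.symm, hne.2.2.symm])
    (fixesAtMostTwo_mul_of_notMem hfix hg) (by
      intro i
      fin_cases i <;> assumption)
  -- Three fixed orbits would give `3 |N| ≤ 2 |s| ≤ 2 |N|`.
  have h1 := s.card_le_univ
  rw [← Nat.card_eq_fintype_card] at h1
  have := Nat.card_pos (α := N)
  simp only [Fintype.card_fin] at hcard
  omega

/-- If `g` fixes two orbits of a semiregular normal subgroup `N`, then every element of the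
coset of `g` fixes a point. -/
theorem exists_fixed_of_two_fixed_orbits [Finite G] (hs : N.ActsSemiregularly Ω) {g : G}
    (hg : g ∉ N) {x y : orbitRel.Quotient N Ω} (hxy : x ≠ y) (hx : g • x = x) (hy : g • y = y)
    {n : G} (hn : n ∈ N) : ∃ ω : Ω, (n * g) • ω = ω := by
  have := Fintype.ofFinite N
  obtain ⟨a, rfl⟩ := orbitMk_surjective N x
  obtain ⟨b, rfl⟩ := orbitMk_surjective N y
  obtain ⟨s, hfs, hcard⟩ := exists_card_mul_card_le hs ![a, b] (by
    intro i j
    fin_cases i <;> fin_cases j <;> simp [hxy, hxy.symm])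
    (fixesAtMostTwo_mul_of_notMem hfix hg) (by
      intro i
      fin_cases i <;> assumption)
  rw [Fintype.card_fin, Nat.card_eq_fintype_card] at hcard
  have : s = Finset.univ := Finset.eq_univ_of_card s (le_antisymm s.card_le_univ (by omega))
  exact hfs ⟨n, hn⟩ (this ▸ Finset.mem_univ _)

end Orbits

theorem card_eq_card_mul_card_orbitRelQuotient {G Ω : Type*} [Group G] [MulAction G Ω] [Finite G]
    [Finite Ω] (N : Subgroup G) (hs : N.ActsSemiregularly Ω) :
    Nat.card Ω = Nat.card N * Nat.card (orbitRel.Quotient N Ω) := by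
  have e : Ω ≃ orbitRel.Quotient N Ω × N := selfEquivOrbitsQuotientProd (fun b => by
    rw [eq_bot_iff]
    intro n hn
    exact Subtype.ext (hs n n.2 b hn))
  rw [Nat.card_congr e, Nat.card_prod, mul_comm]

/-! ### Paired orbits of a normal subgroup abelian modulo `N` -/

/-- Modulo `N`, which acts trivially, the orbits of `M` on `X` are the pairs `{x, σ x}`, and the
fixed points of an element of `M` outside `N` form at most one such pair. Every pair occurs. -/
structure HasPairedOrbits {G X : Type*} [Group G] [MulAction G X] (N M : Subgroup G)
    (σ : X → X) : Prop where
  partner_ne : ∀ x : X, σ x ≠ x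
  smul_eq : ∀ m ∈ M, ∀ x : X, m • x = x ∨ m • x = σ x
  exists_swap : ∀ x : X, ∃ m ∈ M, m • x = σ x
  exists_fix : ∀ x : X, ∃ t ∈ M, t ∉ N ∧ t • x = x
  eq_of_fix : ∀ t ∈ M, t ∉ N → ∀ x y : X, t • x = x → t • y = y → y = x ∨ y = σ x

namespace HasPairedOrbits

variable {G X : Type*} [Group G] [MulAction G X] {N M : Subgroup G} {σ : X → X}
  (h : HasPairedOrbits N M σ)

include h

theorem partner_partner (x : X) : σ (σ x) = x := by
  obtain ⟨m, hm, hx⟩ := h.exists_swap x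
  have : m⁻¹ • σ x = x := by rw [← hx, inv_smul_smul]
  rcases h.smul_eq m⁻¹ (M.inv_mem hm) (σ x) with h1 | h1
  · exact absurd (h1.symm.trans this) (h.partner_ne x)
  · exact h1.symm.trans this

theorem smul_partner_of_fix {m : G} (hm : m ∈ M) {x : X} (hx : m • x = x) :
    m • σ x = σ x := by
  rcases h.smul_eq m hm (σ x) with h1 | h1
  · exact h1
  · rw [h.partner_partner] at h1
    exact absurd (MulAction.injective m (h1.trans hx.symm)) (h.partner_ne x)

theorem smul_partner_of_swap {m : G} (hm : m ∈ M) {x : X} (hx : m • x = σ x) :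
    m • σ x = x := by
  rcases h.smul_eq m hm (σ x) with h1 | h1
  · exact absurd (MulAction.injective m (h1.trans hx.symm)) (h.partner_ne x)
  · rwa [h.partner_partner] at h1

theorem mul_self_smul {m : G} (hm : m ∈ M) (x : X) : (m * m) • x = x := by
  rw [mul_smul]
  rcases h.smul_eq m hm x with h1 | h1
  · rw [h1, h1]
  · rw [h1, h.smul_partner_of_swap hm h1]

end HasPairedOrbits

/-- As `M` is abelian modulo the kernel `N`, the fixed points of each `t` in `M` form an
`M`-invariant set. Outside `N` this set has at most two points, and no point is fixed by all of `M`,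
so it is empty or a single `M`-orbit of length two. By transitivity every point lies in such a set.
-/
theorem exists_hasPairedOrbits {G X : Type*} [Group G] [MulAction G X] [IsPretransitive G X]
    {N M : Subgroup G} [N.Normal] [M.Normal] (hN : ∀ n ∈ N, ∀ x : X, n • x = x)
    (hker : ∀ g : G, (∀ x : X, g • x = x) → g ∈ N) (hX : ∀ g ∉ N, FixesAtMostTwo g X)
    (hcomm : ∀ a ∈ M, ∀ b ∈ M, a * b * a⁻¹ * b⁻¹ ∈ N)
    (ht : ∃ t ∈ M, t ∉ N ∧ ∃ x : X, t • x = x) :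
    ∃ σ : X → X, HasPairedOrbits N M σ := by
  obtain ⟨t, htM, htN, x₀, hx₀⟩ := ht
  have hfix : ∀ x : X, ∃ t ∈ M, t ∉ N ∧ t • x = x := fun x => by
    obtain ⟨g, rfl⟩ := exists_smul_eq G x₀ x
    refine ⟨g * t * g⁻¹, Subgroup.Normal.conj_mem ‹_› t htM g, fun h => htN ?_, ?_⟩
    · have := Subgroup.Normal.conj_mem ‹N.Normal› _ h g⁻¹
      simpa [mul_assoc] using this
    · simp [mul_smul, hx₀]
  have hmove : ∀ x : X, ∃ m ∈ M, m • x ≠ x := fun x => by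
    by_contra! hall
    refine htN (hker t fun y => ?_)
    obtain ⟨g, rfl⟩ := exists_smul_eq G x y
    have := hall _ (Subgroup.Normal.conj_mem ‹M.Normal› t htM g⁻¹)
    rwa [mul_smul, mul_smul, inv_smul_eq_iff, inv_inv] at this
  have hprop : ∀ t ∈ M, ∀ m ∈ M, ∀ x : X, t • x = x → t • m • x = m • x := by
    intro t ht m hm x hx
    have h1 := hN _ (hcomm t ht m hm) (m • t • x)
    simp only [smul_smul] at h1
    have h2 : t * m * t⁻¹ * m⁻¹ * (m * t) = t * m := by group
    rwa [h2, mul_smul, mul_smul, hx] at h1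
  choose u hu hux using hmove
  refine ⟨fun x => u x • x, hux, fun m hm x => ?_, fun x => ⟨u x, hu x, rfl⟩, hfix, ?_⟩
  · obtain ⟨s, hs, hsN, hsx⟩ := hfix x
    rcases hX s hsN _ _ _ hsx (hprop s hs m hm x hsx) (hprop s hs _ (hu x) x hsx) with h | h | h
    · exact Or.inl h.symm
    · exact absurd h.symm (hux x)
    · exact Or.inr h
  · intro s hs hsN x y hx hy
    rcases hX s hsN _ _ _ hx hy (hprop s hs _ (hu x) x hx) with h | h | h
    · exact Or.inl h.symm
    · exact absurd h.symm (hux x)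
    · exact Or.inr h

/-- If `N` is a maximal semiregular normal subgroup, then no element of `M` outside `N` acts
without fixed points on the set of `N`-orbits. -/
theorem HasPairedOrbits.exists_fixed_of_maximal {G Ω : Type*} [Group G] [MulAction G Ω]
    [Nonempty Ω]
    {N M : Subgroup G} [N.Normal] [M.Normal] {σ : orbitRel.Quotient N Ω → orbitRel.Quotient N Ω}
    (h : HasPairedOrbits N M σ) (hs : N.ActsSemiregularly Ω) (hNM : N ≤ M)
    (hker : ∀ g : G, (∀ x : orbitRel.Quotient N Ω, g • x = x) → g ∈ N)
    (hmax : ∀ R : Subgroup G, R.Normal → R.ActsSemiregularly Ω → N ≤ R → R ≤ N)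
    {m : G} (hm : m ∈ M) : ∃ x : orbitRel.Quotient N Ω, m • x = x := by
  -- `D` consists of the elements of `M` inducing the identity or `σ`. An element inducing `σ` fixes
  -- no point of `Ω`, so `D` is semiregular and lies in `N`; an element of `M` without fixed orbits
  -- would induce `σ`.
  let D : Subgroup G :=
    { carrier := {d | d ∈ M ∧ ((∀ x : orbitRel.Quotient N Ω, d • x = x) ∨
        ∀ x : orbitRel.Quotient N Ω, d • x = σ x)}
      one_mem' := ⟨M.one_mem, Or.inl fun x => one_smul G x⟩
      mul_mem' := by
        rintro a b ⟨ha, ha'⟩ ⟨hb, hb'⟩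
        refine ⟨M.mul_mem ha hb, ?_⟩
        rcases ha' with ha' | ha' <;> rcases hb' with hb' | hb' <;>
          simp [mul_smul, ha', hb', h.partner_partner]
      inv_mem' := by
        rintro a ⟨ha, ha'⟩
        refine ⟨M.inv_mem ha, ha'.imp (fun h' x => ?_) fun h' x => ?_⟩
        · rw [inv_smul_eq_iff, h']
        · rw [inv_smul_eq_iff, h', h.partner_partner] }
  have hD : D.Normal := ⟨by
    rintro d ⟨hd, hd'⟩ g
    have hgd : g * d * g⁻¹ ∈ M := Subgroup.Normal.conj_mem ‹_› d hd g
    refine ⟨hgd, hd'.imp (fun h' x => ?_) fun h' x => ?_⟩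
    · simp [mul_smul, h']
    · refine (h.smul_eq _ hgd x).resolve_left fun h1 => h.partner_ne (g⁻¹ • x) ?_
      rwa [mul_smul, mul_smul, h', ← eq_inv_smul_iff] at h1⟩
  have hND : N ≤ D := fun n hn =>
    ⟨hNM hn, Or.inl fun x => smul_orbitRelQuotient_of_mem N hn x⟩
  have hDs : D.ActsSemiregularly Ω := by
    rintro d ⟨hd, hd'⟩ ω hω
    refine hs d (hker d ?_) ω hω
    refine hd'.resolve_right fun h' => h.partner_ne (orbitMk N ω) ?_
    rw [← h', smul_orbitMk, hω]
  by_contra! hne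
  have hmN : m ∈ N := hmax D hD hDs hND
    ⟨hm, Or.inr fun x => (h.smul_eq m hm x).resolve_left (hne x)⟩
  obtain ⟨ω⟩ := ‹Nonempty Ω›
  exact hne (orbitMk N ω) (smul_orbitRelQuotient_of_mem N hmN _)

theorem commute_of_mul_self_eq_one {G : Type*} [Group G] {M : Subgroup G}
    (hM : ∀ m ∈ M, m * m = 1) {a b : G} (ha : a ∈ M) (hb : b ∈ M) : a * b = b * a := by
  have h1 := hM _ (M.mul_mem ha hb)
  have h2 := hM a ha
  have h3 := hM b hb
  have : a * b = a * (a * b * (a * b)) * b := by rw [h1, mul_one]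
  calc a * b = a * (a * b * (a * b)) * b := this
    _ = (a * a) * (b * a) * (b * b) := by group
    _ = b * a := by rw [h2, h3, one_mul, mul_one]

/-- A maximal semiregular normal subgroup is trivial if it has paired orbits. -/
theorem HasPairedOrbits.eq_bot_of_maximal {G Ω : Type*} [Group G] [Finite G] [MulAction G Ω]
    [Nonempty Ω] {N M : Subgroup G} [N.Normal] [M.Normal]
    {σ : orbitRel.Quotient N Ω → orbitRel.Quotient N Ω}
    (hfix : ∀ g : G, g ≠ 1 → FixesAtMostTwo g Ω)
    (h : HasPairedOrbits N M σ) (hs : N.ActsSemiregularly Ω) (hNM : N ≤ M)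
    (hker : ∀ g : G, (∀ x : orbitRel.Quotient N Ω, g • x = x) → g ∈ N)
    (hmax : ∀ R : Subgroup G, R.Normal → R.ActsSemiregularly Ω → N ≤ R → R ≤ N) :
    N = ⊥ ∧ ∀ m ∈ M, m * m = 1 := by
  have hpt : ∀ m ∈ M, m ∉ N → ∃ ω : Ω, m • ω = ω := fun m hm hmN => by
    obtain ⟨x, hx⟩ := h.exists_fixed_of_maximal hs hNM hker hmax hm
    simpa using exists_fixed_of_two_fixed_orbits hfix hs hmN (h.partner_ne x).symm hx
      (h.smul_partner_of_fix hm hx) N.one_mem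
  have hsq : ∀ m ∈ M, m ∉ N → m * m = 1 := fun m hm hmN => by
    obtain ⟨ω, hω⟩ := hpt m hm hmN
    exact hs _ (hker _ (h.mul_self_smul hm)) ω (by rw [mul_smul, hω, hω])
  have ω₀ : Ω := Classical.arbitrary Ω
  obtain ⟨a, ha, haN, hax⟩ := h.exists_fix (orbitMk N ω₀)
  obtain ⟨b, hb, hbx⟩ := h.exists_swap (orbitMk N ω₀)
  have hbN : b ∉ N := fun hbN => h.partner_ne (orbitMk N ω₀)
    (hbx.symm.trans (smul_orbitRelQuotient_of_mem N hbN _))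
  have habN : a * b ∉ N := fun habN => h.partner_ne (orbitMk N ω₀) (by
    have h1 := smul_orbitRelQuotient_of_mem N habN (orbitMk N ω₀)
    rwa [mul_smul, hbx, h.smul_partner_of_fix ha hax] at h1)
  -- The involutions `a`, `b` and `a * b` all invert `n`, but inverting twice is the identity, so `n
  -- = n⁻¹`.
  have hsqN : ∀ n ∈ N, n * n = 1 := fun n hn => by
    have key : ∀ m ∈ M, m ∉ N → m * n * m = n⁻¹ := fun m hm hmN => by
      have h1 := hsq (n * m) (M.mul_mem (hNM hn) hm)
        fun h' => hmN ((N.mul_mem_cancel_left hn).mp h')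
      rw [mul_assoc] at h1
      rw [mul_assoc]
      exact eq_inv_of_mul_eq_one_right h1
    have hab : a * b = b * a := by
      have h1 := hsq _ (M.mul_mem ha hb) habN
      have h2 := hsq _ ha haN
      have h3 := hsq _ hb hbN
      rw [← mul_inv_eq_one, mul_inv_rev, inv_eq_of_mul_eq_one_right h2,
        inv_eq_of_mul_eq_one_right h3]
      exact h1
    have h1 := key _ (M.mul_mem ha hb) habN
    have h2 : a * b * n * (a * b) = a * (b * n * b) * a := by
      nth_rewrite 2 [hab]
      group
    have h3 : a * n⁻¹ * a = n := by
      have := congrArg (·⁻¹) (key a ha haN)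
      simpa [mul_assoc, inv_eq_of_mul_eq_one_right (hsq _ ha haN)] using this
    rw [h2, key b hb hbN, h3] at h1
    exact mul_eq_one_iff_eq_inv.mpr h1
  have hsqM : ∀ m ∈ M, m * m = 1 := fun m hm => by
    by_cases hmN : m ∈ N
    exacts [hsqN m hmN, hsq m hm hmN]
  refine ⟨(Subgroup.eq_bot_iff_forall _).mpr fun n hn => ?_, hsqM⟩
  -- `M` is now abelian, so a fixed point `ω` of `a` yields the fixed points `n • ω` and `m • ω`:
  -- three distinct ones if `n ≠ 1`.
  by_contra hn1
  obtain ⟨ω, hω⟩ := hpt a ha haN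
  obtain ⟨m, hm, hmx⟩ := h.exists_swap (orbitMk N ω)
  have hfixed : ∀ m ∈ M, a • m • ω = m • ω := fun m hm => by
    rw [smul_smul, commute_of_mul_self_eq_one hsqM ha hm, mul_smul, hω]
  rcases hfix a (fun h' => haN (h' ▸ N.one_mem)) _ _ _ hω (hfixed n (hNM hn)) (hfixed m hm)
    with h1 | h1 | h1
  · exact hn1 (hs n hn ω h1.symm)
  · refine h.partner_ne (orbitMk N ω) ?_
    rw [← hmx, smul_orbitMk, ← h1]
  · refine h.partner_ne (orbitMk N ω) ?_
    rw [← hmx, smul_orbitMk, ← h1, ← smul_orbitMk, smul_orbitRelQuotient_of_mem N hn]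

/-! ### The Klein four-group and its three pairs of points -/

section KleinFour

variable {G Ω : Type*} [Group G] [MulAction G Ω] {M : Subgroup G} {σ : Ω → Ω}

/-- If every element of `M` fixes a point and there are at least two paired orbits, then there are
exactly three of them. -/
theorem HasPairedOrbits.exists_six_points
    (h : HasPairedOrbits ⊥ M σ) (hpt : ∀ m ∈ M, ∃ ω : Ω, m • ω = ω)
    (hne : ∃ x y : Ω, y ≠ x ∧ y ≠ σ x) :
    ∃ a ∈ M, ∃ x y z : Ω, a ≠ 1 ∧ a • x = x ∧ [x, σ x, y, σ y, z, σ z].Nodup ∧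
      ∀ w : Ω, w ∈ [x, σ x, y, σ y, z, σ z] := by
  obtain ⟨x, y, hyx, hyx'⟩ := hne
  obtain ⟨a, ha, ha1, hax⟩ := h.exists_fix x
  obtain ⟨b, hb, hb1, hby⟩ := h.exists_fix y
  rw [Subgroup.mem_bot] at ha1 hb1
  have hone : ∀ m ∈ M, ∀ u v : Ω, m • u = u → m • v = v → v ≠ u → v ≠ σ u → m = 1 := by
    intro m hm u v hu hv h1 h2
    by_contra hm1
    exact (h.eq_of_fix m hm (by rwa [Subgroup.mem_bot]) u v hu hv).elim h1 h2
  have hay : a • y = σ y := (h.smul_eq a ha y).resolve_left fun h1 =>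
    ha1 (hone a ha x y hax h1 hyx hyx')
  have hbx : b • x = σ x := (h.smul_eq b hb x).resolve_left fun h1 =>
    hb1 (hone b hb x y h1 hby hyx hyx')
  have habx : (a * b) • x = σ x := by rw [mul_smul, hbx, h.smul_partner_of_fix ha hax]
  have haby : (a * b) • y = σ y := by rw [mul_smul, hby, hay]
  -- `a * b` swaps both known pairs, so its fixed point `z` belongs to a third.
  obtain ⟨z, hz⟩ := hpt _ (M.mul_mem ha hb)
  have hab := M.mul_mem ha hb
  -- An element of `M` is determined by whether it swaps the pair of `x` and the pair of `y`.
  have hM4 : ∀ m ∈ M, m = 1 ∨ m = a ∨ m = b ∨ m = a * b := by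
    intro m hm
    have key : ∀ c ∈ M, m • x = c • x → m • y = c • y → m = c := fun c hc h1 h2 => by
      have := hone (c⁻¹ * m) (M.mul_mem (M.inv_mem hc) hm) x y
        (by rw [mul_smul, h1, inv_smul_smul]) (by rw [mul_smul, h2, inv_smul_smul]) hyx hyx'
      exact (inv_mul_eq_one.mp this).symm
    rcases h.smul_eq m hm x with h1 | h1 <;> rcases h.smul_eq m hm y with h2 | h2
    · exact Or.inl (key 1 M.one_mem (by rwa [one_smul]) (by rwa [one_smul]))
    · exact Or.inr (Or.inl (key a ha (by rw [h1, hax]) (by rw [h2, hay])))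
    · exact Or.inr (Or.inr (Or.inl (key b hb (by rw [h1, hbx]) (by rw [h2, hby]))))
    · exact Or.inr (Or.inr (Or.inr (key _ hab (by rw [h1, habx]) (by rw [h2, haby]))))
  have hpp := h.partner_partner
  have hpn := h.partner_ne
  have hzx : z ≠ x := fun e => hpn x (by rw [← habx, ← e, hz])
  have hzx' : z ≠ σ x := fun e => hpn x (by
    rw [← e, ← hz, ← h.smul_partner_of_swap hab habx, ← e, hz])
  have hzy : z ≠ y := fun e => hpn y (by rw [← haby, ← e, hz])
  have hzy' : z ≠ σ y := fun e => hpn y (by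
    rw [← e, ← hz, ← h.smul_partner_of_swap hab haby, ← e, hz])
  have hσ : ∀ u v : Ω, σ u = σ v → u = v := fun u v e => by rw [← hpp u, e, hpp]
  have hσ' : ∀ u v : Ω, σ u = v → u = σ v := fun u v e => by rw [← e, hpp]
  refine ⟨a, ha, x, y, z, ha1, hax, ?_, fun w => ?_⟩
  · simp only [List.nodup_cons, List.mem_cons, List.not_mem_nil, or_false, not_or,
      not_false_eq_true, List.nodup_nil, and_true]
    refine ⟨⟨(hpn x).symm, hyx.symm, fun e => hyx' (hσ' _ _ e.symm), hzx.symm,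
      fun e => hzx' (hσ' _ _ e.symm)⟩, ⟨hyx'.symm, fun e => hyx (hσ _ _ e.symm), hzx'.symm,
      fun e => hzx (hσ _ _ e.symm)⟩, ⟨(hpn y).symm, hzy.symm, fun e => hzy' (hσ' _ _ e.symm)⟩,
      ⟨hzy'.symm, fun e => hzy (hσ _ _ e.symm)⟩, (hpn z).symm⟩
  · obtain ⟨t, ht, ht1, htw⟩ := h.exists_fix w
    have := h.eq_of_fix t ht ht1
    rw [Subgroup.mem_bot] at ht1
    simp only [List.mem_cons, List.not_mem_nil, or_false]
    rcases hM4 t ht with rfl | rfl | rfl | rfl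
    · exact absurd rfl ht1
    · rcases this x w hax htw with h1 | h1 <;> simp [h1]
    · rcases this y w hby htw with h1 | h1 <;> simp [h1]
    · rcases this z w hz htw with h1 | h1 <;> simp [h1]

/-- An elementary abelian `2`-group with at least two paired orbits contains its centralizer. -/
theorem HasPairedOrbits.mem_of_commute (h : HasPairedOrbits ⊥ M σ)
    (hM : ∀ m ∈ M, m * m = 1) (hfix : ∀ g : G, g ≠ 1 → FixesAtMostTwo g Ω) (hne : ∃ x y : Ω, y ≠ x ∧ y ≠ σ x) {g : G}
    (hg : ∀ m ∈ M, g * m = m * g) : g ∈ M := by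
  obtain ⟨x, y, hyx, hyx'⟩ := hne
  -- An element centralizing `M` preserves each pair, as the fixed set of some `t` in `M`.
  -- Multiplying by elements of `M` makes it fix `x` and then `y`, after which it is trivial.
  have hpair : ∀ k : G, (∀ m ∈ M, k * m = m * k) → ∀ w : Ω, k • w = w ∨ k • w = σ w := by
    intro k hk w
    obtain ⟨t, ht, ht1, htw⟩ := h.exists_fix w
    exact h.eq_of_fix t ht ht1 w _ htw (by rw [smul_smul, ← hk t ht, mul_smul, htw])
  have hσ : ∀ k : G, (∀ m ∈ M, k * m = m * k) → k • x = x → k • σ x = σ x := by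
    intro k hk hx
    obtain ⟨m, hm, hmx⟩ := h.exists_swap x
    rw [← hmx, smul_smul, hk m hm, mul_smul, hx]
  have hcomm : ∀ k : G, (∀ m ∈ M, k * m = m * k) → ∀ b ∈ M, ∀ m ∈ M,
      b⁻¹ * k * m = m * (b⁻¹ * k) := by
    intro k hk b hb m hm
    rw [mul_assoc, hk m hm, ← mul_assoc, ← mul_assoc,
      commute_of_mul_self_eq_one hM (M.inv_mem hb) hm]
  have hone : ∀ k : G, (∀ m ∈ M, k * m = m * k) → k • x = x → k • y = y → k = 1 := by
    intro k hk hx hy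
    by_contra hk1
    rcases hfix k hk1 _ _ _ hx (hσ k hk hx) hy with e | e | e
    · exact h.partner_ne x e.symm
    · exact hyx e.symm
    · exact hyx' e.symm
  have hmem : ∀ k : G, (∀ m ∈ M, k * m = m * k) → k • x = x → k ∈ M := by
    intro k hk hx
    rcases hpair k hk y with hy | hy
    · exact hone k hk hx hy ▸ M.one_mem
    · obtain ⟨a, ha, ha1, hax⟩ := h.exists_fix x
      have hay : a • y = σ y := (h.smul_eq a ha y).resolve_left fun h1 =>
        (h.eq_of_fix a ha ha1 x y hax h1).elim hyx hyx'
      have := hone (a⁻¹ * k) (hcomm k hk a ha) (by rw [mul_smul, hx, inv_smul_eq_iff, hax])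
        (by rw [mul_smul, hy, ← hay, inv_smul_smul])
      rwa [← inv_mul_eq_one.mp this]
  rcases hpair g hg x with hx | hx
  · exact hmem g hg hx
  · obtain ⟨b, hb, hbx⟩ := h.exists_swap x
    have := hmem (b⁻¹ * g) (hcomm g hg b hb) (by rw [mul_smul, hx, ← hbx, inv_smul_smul])
    rwa [M.mul_mem_cancel_left (M.inv_mem hb)] at this

theorem HasPairedOrbits.smul_partner [M.Normal] {N : Subgroup G} (h : HasPairedOrbits N M σ)
    (g : G) (w : Ω) : g • σ w = σ (g • w) := by
  obtain ⟨m, hm, hmw⟩ := h.exists_swap w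
  have hgw : g • σ w = (g * m * g⁻¹) • g • w := by
    rw [← hmw, smul_smul, smul_smul]
    group
  rcases h.smul_eq _ (Subgroup.Normal.conj_mem ‹_› m hm g) (g • w) with h1 | h1
  · exact absurd (MulAction.injective g (hgw.trans h1)) (h.partner_ne w)
  · exact hgw.trans h1

end KleinFour

/-! ### Identification of the group on six points -/

theorem natCard_eq_length_of_nodup {α : Type*} (p : α → Prop) {l : List α} (hl : l.Nodup)
    (hp : ∀ a, p a ↔ a ∈ l) : Nat.card {a // p a} = l.length := by
  classical
  rw [← List.toFinset_card_of_nodup hl]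
  exact Nat.subtype_card _ fun a => by rw [List.mem_toFinset, hp]

/-- A group of order `12` or `24` acting faithfully on a set of size four is isomorphic to the
alternating or to the symmetric group of degree four. -/
theorem nonempty_mulEquiv_alternatingGroup_or_perm {G S : Type*} [Group G] [MulAction G S]
    (hS : Nat.card S = 4) (hcard : Nat.card G = 12 ∨ Nat.card G = 24)
    (hinj : Function.Injective (toPermHom G S)) :
    Nonempty (G ≃* alternatingGroup (Fin 4)) ∨ Nonempty (G ≃* Equiv.Perm (Fin 4)) := by
  have : Finite S := Nat.finite_of_card_ne_zero (by omega)
  let e : S ≃ Fin 4 := Finite.equivFinOfCardEq hS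
  let f : G →* Equiv.Perm (Fin 4) := (e.permCongrHom : _ →* _).comp (toPermHom G S)
  have hf : Function.Injective f := e.permCongrHom.injective.comp hinj
  have h24 : Nat.card (Equiv.Perm (Fin 4)) = 24 := by
    rw [Nat.card_eq_fintype_card, Fintype.card_perm, Fintype.card_fin]
    rfl
  have hr : Nat.card f.range = Nat.card G := (Nat.card_congr (f.ofInjective hf).toEquiv).symm
  have hmul := f.range.card_mul_index
  rw [h24, hr] at hmul
  rcases hcard with h | h <;> rw [h] at hmul
  · left
    have h2 : f.range = alternatingGroup (Fin 4) :=
      Equiv.Perm.eq_alternatingGroup_of_index_eq_two (by omega)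
    exact ⟨(f.ofInjective hf).trans (MulEquiv.subgroupCongr h2)⟩
  · right
    have h1 : f.range = ⊤ := Subgroup.index_eq_one.mp (by omega)
    exact ⟨MulEquiv.ofBijective f ⟨hf, f.range_eq_top.mp h1⟩⟩

section Octahedron

variable {G Ω : Type*} [Group G] [Finite G] [MulAction G Ω] [IsPretransitive G Ω] [Nonempty Ω]
  {M : Subgroup G} [M.Normal] {σ : Ω → Ω}

omit [Nonempty Ω] in
theorem HasPairedOrbits.card_eq_six
    (h : HasPairedOrbits ⊥ M σ) (hM : ∀ m ∈ M, m * m = 1)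
    (hfix : ∀ g : G, g ≠ 1 → FixesAtMostTwo g Ω)
    (hpt : ∀ m ∈ M, ∃ ω : Ω, m • ω = ω) (hne : ∃ x y : Ω, y ≠ x ∧ y ≠ σ x) :
    Nat.card Ω = 6 ∧ (Nat.card G = 12 ∨ Nat.card G = 24) := by
  obtain ⟨a, ha, x, y, z, ha1, hax, hl, hmem⟩ := h.exists_six_points hpt hne
  have h6 : Nat.card Ω = 6 := by
    rw [← Nat.card_congr (Equiv.subtypeUnivEquiv (p := fun _ : Ω => True) fun _ => trivial)]
    exact natCard_eq_length_of_nodup _ hl fun w => by simp only [true_iff]; exact hmem w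
  have hl' : [y, σ y, z, σ z].Nodup := hl.of_cons.of_cons
  have h4 : Nat.card {w : Ω // w ≠ x ∧ w ≠ σ x} = 4 :=
    natCard_eq_length_of_nodup _ hl' fun w => by
      have h1 := hmem w
      simp only [List.nodup_cons, List.mem_cons, List.not_mem_nil, or_false, not_or] at h1 hl ⊢
      grind
  -- The stabilizer of `x` also fixes `σ x`, so its elements are told apart by the image of `y`
  -- among the other four points. Its order is even because it contains `a`, hence is 2 or 4.
  have hle : Nat.card (stabilizer G x) ≤ 4 := by
    rw [← h4]
    have : Finite {w : Ω // w ≠ x ∧ w ≠ σ x} := Nat.finite_of_card_ne_zero (by omega)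
    have hyx : y ≠ x ∧ y ≠ σ x := by
      simp only [List.nodup_cons, List.mem_cons, List.not_mem_nil, or_false, not_or] at hl
      grind
    have hσx : ∀ g : stabilizer G x, (g : G) • σ x = σ x := fun g => by
      rw [h.smul_partner, g.2]
    refine Nat.card_le_card_of_injective (fun g : stabilizer G x =>
      (⟨(g : G) • y, fun e => hyx.1 (MulAction.injective (g : G) (e.trans g.2.symm)),
        fun e => hyx.2 (MulAction.injective (g : G) (e.trans (hσx g).symm))⟩ :
        {w : Ω // w ≠ x ∧ w ≠ σ x})) fun g k hgk => ?_
    have hgk' : (g : G) • y = (k : G) • y := congrArg Subtype.val hgk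
    by_contra hne'
    rcases hfix ((k : G)⁻¹ * g) (fun e => hne' (Subtype.ext (inv_mul_eq_one.mp e).symm)) x (σ x) y
      (by rw [mul_smul, g.2, inv_smul_eq_iff, k.2])
      (by rw [mul_smul, hσx, inv_smul_eq_iff, hσx])
      (by rw [mul_smul, hgk', inv_smul_smul]) with e | e | e
    · exact h.partner_ne x e.symm
    · exact hyx.1 e.symm
    · exact hyx.2 e.symm
  have hdvd : 2 ∣ Nat.card (stabilizer G x) := by
    have : orderOf (⟨a, hax⟩ : stabilizer G x) = 2 :=
      orderOf_eq_prime (Subtype.ext (by simpa [sq] using hM a ha))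
        fun e => ha1 (congrArg Subtype.val e)
    exact this ▸ orderOf_dvd_natCard _
  have hpos : 0 < Nat.card (stabilizer G x) := Nat.card_pos
  have hmul := (stabilizer G x).card_mul_index
  rw [index_stabilizer_of_transitive, h6] at hmul
  exact ⟨h6, by omega⟩

/-- The set of size four on which `G` acts faithfully is its set of Sylow 3-subgroups. -/
theorem HasPairedOrbits.nonempty_mulEquiv
    (h : HasPairedOrbits ⊥ M σ) (hM : ∀ m ∈ M, m * m = 1)
    (hfix : ∀ g : G, g ≠ 1 → FixesAtMostTwo g Ω)
    (hpt : ∀ m ∈ M, ∃ ω : Ω, m • ω = ω) (hne : ∃ x y : Ω, y ≠ x ∧ y ≠ σ x) :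
    Nonempty (G ≃* alternatingGroup (Fin 4)) ∨ Nonempty (G ≃* Equiv.Perm (Fin 4)) := by
  obtain ⟨h6, hG⟩ := h.card_eq_six hM hfix hpt hne
  have : Fact (Nat.Prime 3) := ⟨Nat.prime_three⟩
  -- Such a `p` preserves the pair fixed by `m`, and having order 3 it fixes both points; but point
  -- stabilizers have order 2 or 4.
  have hcommute : ∀ m ∈ M, ∀ p : G, orderOf p = 3 → p * m = m * p → m = 1 := by
    intro m hm p hp hpm
    by_contra hm1
    obtain ⟨w, hw⟩ := hpt m hm
    have hpw := h.eq_of_fix m hm hm1 w (p • w) hw (by rw [smul_smul, ← hpm, mul_smul, hw])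
    have hp2 : p • p • w = w := by
      rcases hpw with e | e
      · rw [e, e]
      · rw [e, h.smul_partner, e, h.partner_partner]
    have hp3 : p ^ 3 = 1 := hp ▸ pow_orderOf_eq_one p
    have hps : p ∈ stabilizer G w := by
      have h1 : p ^ 3 • w = p • w := by rw [pow_succ', sq, mul_smul, mul_smul, hp2]
      rwa [hp3, one_smul, eq_comm] at h1
    have h3 : 3 ∣ Nat.card (stabilizer G w) := by
      rw [← hp, ← Subgroup.orderOf_mk p hps]
      exact orderOf_dvd_natCard _
    have hmul := (stabilizer G w).card_mul_index
    rw [index_stabilizer_of_transitive, h6] at hmul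
    omega
  -- The commutator of `m` with an element of `P` lies in both `P` and `M`, so it has 3-power order
  -- and trivial square.
  have hnorm : ∀ P : Sylow 3 G, ∀ m ∈ M, m • P = P → m = 1 := by
    intro P m hm hmP
    obtain ⟨p, hp⟩ := exists_prime_orderOf_dvd_card' (G := P) 3
      (P.dvd_card_of_dvd_card (by omega))
    refine hcommute m hm p (by rwa [Subgroup.orderOf_coe]) ?_
    have hconj : m * p * m⁻¹ ∈ P :=
      (Subgroup.mem_normalizer_iff.mp (Sylow.smul_eq_iff_mem_normalizer.mp hmP) p).mp p.2
    have hcP : m * p * m⁻¹ * (p : G)⁻¹ ∈ P := P.mul_mem hconj (P.inv_mem p.2)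
    have hcM : m * p * m⁻¹ * (p : G)⁻¹ ∈ M := by
      have := M.mul_mem hm (Subgroup.Normal.conj_mem ‹M.Normal› _ (M.inv_mem hm) (p : G))
      simpa [mul_assoc] using this
    have h1 : m * p * m⁻¹ * (p : G)⁻¹ = 1 := by
      obtain ⟨k, hk⟩ := P.2 ⟨_, hcP⟩
      have hk' : (m * p * m⁻¹ * (p : G)⁻¹) ^ 3 ^ k = 1 := congrArg Subtype.val hk
      have h2 : (m * p * m⁻¹ * (p : G)⁻¹) ^ 2 = 1 := by rw [sq]; exact hM _ hcM
      have := pow_gcd_eq_one.mpr ⟨hk', h2⟩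
      rwa [Nat.Coprime.gcd_eq_one (Nat.Coprime.pow_left k (by norm_num)), pow_one] at this
    rw [mul_inv_eq_one, mul_inv_eq_iff_eq_mul] at h1
    exact h1.symm
  obtain ⟨P⟩ : Nonempty (Sylow 3 G) := inferInstance
  have hS : Nat.card (Sylow 3 G) = 4 := by
    have h1 : Nat.card (Sylow 3 G) % 3 = 1 := card_sylow_modEq_one 3 G
    have h2 : Nat.card (Sylow 3 G) ∣ 24 := by
      have := (P.card_eq_index_normalizer ▸ Subgroup.index_dvd_card _ :
        Nat.card (Sylow 3 G) ∣ Nat.card G)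
      rcases hG with hG | hG
      · exact this.trans (by rw [hG]; norm_num)
      · rwa [hG] at this
    have h3 : Nat.card (Sylow 3 G) ≠ 1 := fun h3 => by
      obtain ⟨hsub, -⟩ := Nat.card_eq_one_iff_unique.mp h3
      obtain ⟨m, hm, hm1, -⟩ := h.exists_fix (Classical.arbitrary Ω)
      exact hm1 (hnorm P m hm (Subsingleton.elim _ _))
    have h4 := Nat.le_of_dvd (by norm_num) h2
    generalize Nat.card (Sylow 3 G) = n at *
    interval_cases n <;> omega
  refine nonempty_mulEquiv_alternatingGroup_or_perm hS hG ?_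
  rw [injective_iff_map_eq_one]
  have hact : ∀ g : G, toPermHom G (Sylow 3 G) g = 1 → ∀ Q : Sylow 3 G, g • Q = Q :=
    fun g hg Q => congrArg (fun π : Equiv.Perm (Sylow 3 G) => π Q) hg
  intro g hg
  -- The commutator of `g` with `m` lies in `M` and in the kernel, hence is trivial; so `g`
  -- centralizes `M` and therefore belongs to it.
  refine hnorm P g (h.mem_of_commute hM hfix hne fun m hm => ?_) (hact g hg P)
  have hcM : g * m * g⁻¹ * m⁻¹ ∈ M :=
    M.mul_mem (Subgroup.Normal.conj_mem ‹_› m hm g) (M.inv_mem hm)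
  have h1 := hnorm P _ hcM (hact _ (by
    rw [map_mul, map_mul, map_mul, hg, map_inv, map_inv, hg]; group) P)
  rwa [mul_inv_eq_one, mul_inv_eq_iff_eq_mul] at h1

end Octahedron

/-! ### The case of two orbits -/

/-- The double transpositions of a set of size four, together with the identity. -/
def doubleTranspositions (Y : Type*) (hY : Nat.card Y = 4) : Subgroup (Equiv.Perm Y) where
  carrier := {π | π = 1 ∨ ∀ y, π y ≠ y ∧ π (π y) = y}
  one_mem' := Or.inl rfl
  inv_mem' := by
    rintro π (rfl | h)
    · exact Or.inl inv_one
    · have hinv : π⁻¹ = π := inv_eq_of_mul_eq_one_right (Equiv.ext fun y => (h y).2)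
      rw [hinv]
      exact Or.inr h
  mul_mem' := by
    intro π ρ hπ hρ
    have : Finite Y := Nat.finite_of_card_ne_zero (by omega)
    let e : Y ≃ Fin 4 := Finite.equivFinOfCardEq hY
    have key : ∀ f g : Equiv.Perm (Fin 4), (∀ i, f i ≠ i ∧ f (f i) = i) →
        (∀ i, g i ≠ i ∧ g (g i) = i) →
        (∀ i, f (g i) = i) ∨ ∀ i, f (g i) ≠ i ∧ f (g (f (g i))) = i := by
      decide
    rcases hπ with rfl | hπ
    · rwa [one_mul]
    rcases hρ with rfl | hρ
    · rw [mul_one]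
      exact Or.inr hπ
    have htrans : ∀ τ : Equiv.Perm Y, (∀ y, τ y ≠ y ∧ τ (τ y) = y) →
        ∀ i, e.permCongr τ i ≠ i ∧ e.permCongr τ (e.permCongr τ i) = i := by
      intro τ hτ i
      obtain ⟨y, rfl⟩ := e.surjective i
      simpa [Equiv.permCongr_apply] using hτ y
    refine (key _ _ (htrans π hπ) (htrans ρ hρ)).imp (fun h => ?_) fun h y => ?_
    · ext y
      simpa [Equiv.permCongr_apply] using h (e y)
    · simpa [Equiv.permCongr_apply] using h (e y)

instance doubleTranspositions_normal (Y : Type*) (hY : Nat.card Y = 4) :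
    (doubleTranspositions Y hY).Normal where
  conj_mem := by
    rintro π (rfl | h) ρ
    · simp
    · refine Or.inr fun y => ⟨fun e => (h (ρ⁻¹ y)).1 ?_, ?_⟩
      · exact Equiv.Perm.eq_inv_iff_eq.mpr e
      · simp [(h _).2]

theorem mem_comap_doubleTranspositions {G Y : Type*} [Group G] [MulAction G Y]
    (hY : Nat.card Y = 4) {g : G} : g ∈ (doubleTranspositions Y hY).comap (toPermHom G Y) ↔
      (∀ y : Y, g • y = y) ∨ ∀ y : Y, g • y ≠ y ∧ g • g • y = y := by
  refine or_congr ?_ Iff.rfl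
  exact Equiv.ext_iff

theorem eq_of_ne_of_card_two {X : Type*} (hX : Nat.card X = 2) {x y z : X}
    (hx : x ≠ z) (hy : y ≠ z) : x = y := by
  have : Finite X := Nat.finite_of_card_ne_zero (by omega)
  have := Fintype.ofFinite X
  by_contra hne
  have h3 : 2 < Fintype.card X := Fintype.two_lt_card_iff.mpr ⟨x, y, z, hne, hx, hy⟩
  rw [← Nat.card_eq_fintype_card] at h3
  omega

theorem smul_eq_of_card_two {G X : Type*} [Group G] [MulAction G X] (hX : Nat.card X = 2)
    {g : G} {x : X} (hx : g • x = x) (y : X) : g • y = y := by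
  by_cases hxy : y = x
  · rw [hxy, hx]
  · exact eq_of_ne_of_card_two hX
      (fun e => hxy (MulAction.injective g (e.trans hx.symm))) hxy

section TwoOrbits

variable {G Ω : Type*} [Group G] [Finite G] [MulAction G Ω] {N : Subgroup G} [N.Normal]

/-- If `N` has two orbits and `h` fixes two points in the same one, then `h` is an involution
which inverts `N`, and the involutions of `N` generate a subgroup of order two. -/
theorem inverts_of_fixes_two_in_orbit (hfix : ∀ g : G, g ≠ 1 → FixesAtMostTwo g Ω)
    (hs : N.ActsSemiregularly Ω) (hX : Nat.card (orbitRel.Quotient N Ω) = 2) {h z : G}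
    (h1 : h ≠ 1) {α : Ω} (hα : h • α = α) (hz : z ∈ N) (hz1 : z ≠ 1) (hzα : h • z • α = z • α) :
    h ∉ N ∧ h * h = 1 ∧ (∀ n ∈ N, h * n * h = n⁻¹) ∧ ∀ n ∈ N, n * n = 1 ↔ n = 1 ∨ n = z := by
  have hhN : h ∉ N := fun hh => h1 (hs h hh α hα)
  have hzne : z • α ≠ α := fun e => hz1 (hs z hz α e)
  -- If `n` commutes with `h`, then `n • α` is one of the two fixed points of `h`.
  have hcent : ∀ n ∈ N, h * n = n * h → n = 1 ∨ n = z := by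
    intro n hn hc
    have hnα : h • n • α = n • α := by rw [smul_smul, hc, mul_smul, hα]
    rcases hfix h h1 _ _ _ hα hzα hnα with e | e | e
    · exact absurd e.symm hzne
    · exact Or.inl (hs n hn α e.symm)
    · exact Or.inr (hs.eq_of_smul_eq hn hz e.symm)
  have hhz : h * z = z * h := by
    have : h * z * h⁻¹ = z := hs.eq_of_smul_eq (Subgroup.Normal.conj_mem ‹_› z hz h) hz (a := α)
      (by rw [mul_smul, mul_smul, inv_smul_eq_iff.mpr hα.symm, hzα])
    rwa [mul_inv_eq_iff_eq_mul] at this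
  have hz2 : z * z = 1 := by
    have := hcent (z * z) (N.mul_mem hz hz) (by rw [← mul_assoc, hhz, mul_assoc, hhz, mul_assoc])
    exact this.resolve_right fun e => hz1 (mul_eq_left.mp e)
  have hx : h • orbitMk N α = orbitMk N α := by rw [smul_orbitMk, hα]
  have hpt : ∀ n ∈ N, ∃ β : Ω, (n * h) • β = β := by
    obtain ⟨y, hy⟩ : ∃ y, orbitMk N α ≠ y := by
      by_contra! hall
      have : Nat.card (orbitRel.Quotient N Ω) = 1 :=
        Nat.card_eq_one_iff_exists.mpr ⟨_, fun y => (hall y).symm⟩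
      omega
    exact fun n hn => exists_fixed_of_two_fixed_orbits hfix hs hhN hy hx
      (smul_eq_of_card_two hX hx y) hn
  -- `z * h` swaps `α` and `z • α`, so its fixed point `β` is a third one for `h * h = (z * h) * (z
  -- * h)`.
  have hh2 : h * h = 1 := by
    obtain ⟨β, hβ⟩ := hpt z hz
    have hβ2 : (h * h) • β = β := by
      have e : z * h * (z * h) = h * h := by
        rw [mul_assoc, ← mul_assoc h, hhz, mul_assoc z h, ← mul_assoc z z, hz2, one_mul]
      rw [← e, mul_smul, hβ, hβ]
    by_contra hne
    rcases hfix _ hne α (z • α) β (by rw [mul_smul, hα, hα]) (by rw [mul_smul, hzα, hzα]) hβ2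
      with e | e | e
    · exact hzne e.symm
    · rw [← e, mul_smul, hα] at hβ
      exact hzne hβ
    · rw [← e, mul_smul, hzα, smul_smul, hz2, one_smul] at hβ
      exact hzne hβ.symm
  have hinv : ∀ n ∈ N, h * n * h = n⁻¹ := by
    intro n hn
    obtain ⟨β, hβ⟩ := hpt n hn
    have hh' : h⁻¹ = h := inv_eq_of_mul_eq_one_right hh2
    have hmem : n * (h * n * h) ∈ N :=
      N.mul_mem hn (by simpa [hh'] using Subgroup.Normal.conj_mem ‹N.Normal› n hn h)
    have := hs _ hmem β (by
      rw [show n * (h * n * h) = n * h * (n * h) by group, mul_smul, hβ, hβ])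
    exact eq_inv_of_mul_eq_one_right this
  refine ⟨hhN, hh2, hinv, fun n hn => ⟨fun hn2 => hcent n hn ?_, ?_⟩⟩
  · have := hinv n hn
    rw [← mul_eq_one_iff_eq_inv.mp hn2] at this
    calc h * n = h * n * (h * h) := by rw [hh2, mul_one]
      _ = (h * n * h) * h := by group
      _ = n * h := by rw [this]
  · rintro (rfl | rfl)
    exacts [one_mul 1, hz2]

omit [Finite G] in
/-- Under the conclusion of `inverts_of_fixes_two_in_orbit`, the squares of the elements of `N`
form a normal subgroup of index two in `N`. -/
theorem exists_normal_squares {h z : G} (hz : z ∈ N) (hz1 : z ≠ 1)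
    (hinv : ∀ n ∈ N, h * n * h = n⁻¹) (hsq : ∀ n ∈ N, n * n = 1 ↔ n = 1 ∨ n = z)
    (hh : h * h = 1) :
    ∃ K : Subgroup G, K.Normal ∧ K ≤ N ∧ (∀ n ∈ N, n * n ∈ K) ∧
      Nat.card N = 2 * Nat.card K := by
  have hcomm : ∀ m ∈ N, ∀ n ∈ N, m * n = n * m := by
    intro m hm n hn
    have h1 : h * (m * n) * h = h * m * h * (h * n * h) := by
      calc h * (m * n) * h = h * m * 1 * n * h := by group
        _ = _ := by rw [← hh]; group
    rw [hinv _ (N.mul_mem hm hn), hinv m hm, hinv n hn, ← mul_inv_rev, inv_inj] at h1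
    exact h1
  -- `N` is abelian because inversion is conjugation by `h`; so squaring is a homomorphism, with
  -- kernel `{1, z}`.
  let f : N →* N := MonoidHom.mk' (fun n => n * n) fun m n => by
    have := hcomm m m.2 n n.2
    ext
    push_cast
    rw [mul_assoc (m : G) n, ← mul_assoc (n : G) m, ← this]
    group
  have hker : Nat.card f.ker = 2 := by
    have e : (f.ker : Set N) = {1, ⟨z, hz⟩} := by
      ext n
      have := hsq n n.2
      simp only [SetLike.mem_coe, MonoidHom.mem_ker, Set.mem_insert_iff, Set.mem_singleton_iff]
      rw [← Subtype.coe_inj, ← Subtype.coe_inj, ← Subtype.coe_inj]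
      exact this
    have := Set.ncard_pair (a := (1 : N)) (b := ⟨z, hz⟩)
      fun e => hz1 (congrArg Subtype.val e).symm
    rwa [← e] at this
  have hmul := f.ker.card_mul_index
  rw [Subgroup.index_ker, hker] at hmul
  refine ⟨f.range.map N.subtype, ⟨?_⟩, ?_, fun n hn => ?_, ?_⟩
  · rintro _ ⟨_, ⟨n, rfl⟩, rfl⟩ g
    refine ⟨_, ⟨⟨g * n * g⁻¹, Subgroup.Normal.conj_mem ‹N.Normal› n n.2 g⟩, rfl⟩, ?_⟩
    simp [f]
  · rintro _ ⟨n, -, rfl⟩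
    exact n.2
  · exact ⟨_, ⟨⟨n, hn⟩, rfl⟩, rfl⟩
  · rw [← hmul, Subgroup.card_map_of_injective N.subtype_injective]

end TwoOrbits

section TwoOrbits

variable {G Ω : Type*} [Group G] [Finite G] [MulAction G Ω] {N : Subgroup G} [N.Normal]

/-- If `N` is a semiregular normal subgroup with two orbits and a nontrivial element fixes two
points of the same orbit, then `N` is not maximal. -/
theorem exists_semiregular_of_fixes_two_in_orbit [IsPretransitive G Ω]
    (hfix : ∀ g : G, g ≠ 1 → FixesAtMostTwo g Ω)
    (hs : N.ActsSemiregularly Ω) (hX : Nat.card (orbitRel.Quotient N Ω) = 2) {h z : G}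
    (h1 : h ≠ 1) {α : Ω} (hα : h • α = α) (hz : z ∈ N) (hz1 : z ≠ 1) (hzα : h • z • α = z • α) :
    ∃ R : Subgroup G, R.Normal ∧ R.ActsSemiregularly Ω ∧ N ≤ R ∧ ¬ R ≤ N := by
  obtain ⟨hhN, hh2, hinv, hsq⟩ := inverts_of_fixes_two_in_orbit hfix hs hX h1 hα hz hz1 hzα
  obtain ⟨K, hK, hKN, hsqK, hcard⟩ := exists_normal_squares hz hz1 hinv hsq hh2
  have hsK : K.ActsSemiregularly Ω := fun k hk => hs k (hKN hk)
  have : Nonempty Ω := ⟨α⟩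
  have hKpos : 0 < Nat.card K := Nat.card_pos
  have hΩ : Finite Ω := Finite.of_surjective (fun g : G => g • α) (exists_smul_eq G α)
  have hY : Nat.card (orbitRel.Quotient K Ω) = 4 := by
    have e1 := card_eq_card_mul_card_orbitRelQuotient N hs
    rw [card_eq_card_mul_card_orbitRelQuotient K hsK, hX, hcard] at e1
    exact Nat.eq_of_mul_eq_mul_left hKpos (by omega)
  obtain ⟨n₀, hn₀, hn₀K⟩ : ∃ n ∈ N, n ∉ K := by
    by_contra! hle
    have := Subgroup.card_le_of_le (show N ≤ K from hle)
    omega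
  obtain ⟨g, hgX⟩ : ∃ g : G, orbitMk N (g • α) ≠ orbitMk N α := by
    by_contra! hall
    have : Nat.card (orbitRel.Quotient N Ω) = 1 := by
      refine Nat.card_eq_one_iff_exists.mpr ⟨orbitMk N α, fun y => ?_⟩
      obtain ⟨b, rfl⟩ := orbitMk_surjective N y
      obtain ⟨g, rfl⟩ := exists_smul_eq G α b
      exact hall g
    omega
  have hKtoN : ∀ {a b : Ω}, orbitMk K a = orbitMk K b → orbitMk N a = orbitMk N b := by
    intro a b hab
    obtain ⟨k, hk, hkb⟩ := (orbitMk_eq_iff K).mp hab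
    exact (orbitMk_eq_iff N).mpr ⟨k, hKN hk, hkb⟩
  have hYN : ∀ n ∈ N, n ∉ K → ∀ y : orbitRel.Quotient K Ω, n • y ≠ y ∧ n • n • y = y := by
    intro n hn hnK y
    refine ⟨fun e => ?_, ?_⟩
    · obtain ⟨a, rfl⟩ := orbitMk_surjective K y
      rw [smul_orbitMk, orbitMk_eq_iff] at e
      obtain ⟨k, hk, hka⟩ := e
      exact hnK (hs.eq_of_smul_eq (hKN hk) hn hka ▸ hk)
    · rw [smul_smul]
      exact smul_orbitRelQuotient_of_mem K (hsqK n hn) y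
  have hN1 : ∀ n ∈ N, ∀ a : Ω, orbitMk N (n • a) = orbitMk N a := fun n hn a =>
    (orbitMk_eq_iff N).mpr ⟨n, hn, rfl⟩
  have hhx : ∀ x : orbitRel.Quotient N Ω, h • x = x :=
    smul_eq_of_card_two hX (x := orbitMk N α) (by rw [smul_orbitMk, hα])
  -- `p`, `q` are the `K`-orbits inside the `N`-orbit of `α`; `g` carries them to `r`, `s` in the
  -- other `N`-orbit.
  let p := orbitMk K α
  let q := orbitMk K (n₀ • α)
  let r := orbitMk K (g • α)
  let s := orbitMk K (g • n₀ • α)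
  have hgn : orbitMk N (g • n₀ • α) = orbitMk N (g • α) := by
    rw [← smul_orbitMk, hN1 n₀ hn₀, smul_orbitMk]
  have hpq : p ≠ q := fun e => (hYN n₀ hn₀ hn₀K p).1 e.symm
  have hpr : p ≠ r := fun e => hgX (hKtoN e).symm
  have hps : p ≠ s := fun e => hgX (hgn ▸ (hKtoN e).symm)
  have hqr : q ≠ r := fun e => hgX ((hKtoN e).symm.trans (hN1 n₀ hn₀ α))
  have hqs : q ≠ s := fun e => hgX (hgn ▸ (hKtoN e).symm.trans (hN1 n₀ hn₀ α))
  have hrs : r ≠ s := fun e => hpq (MulAction.injective g e)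
  have hall : ∀ y : orbitRel.Quotient K Ω, y = p ∨ y = q ∨ y = r ∨ y = s := by
    have hYf : Finite (orbitRel.Quotient K Ω) := Nat.finite_of_card_ne_zero (by omega)
    have := Fintype.ofFinite (orbitRel.Quotient K Ω)
    classical
    intro y
    have h4 : ({p, q, r, s} : Finset (orbitRel.Quotient K Ω)) = Finset.univ := by
      refine Finset.eq_univ_of_card _ ?_
      rw [← Nat.card_eq_fintype_card, hY]
      simp [hpq, hpr, hps, hqr, hqs, hrs]
    have hy := Finset.mem_univ y
    rw [← h4] at hy
    simpa using hy
  have hhp : h • p = p := congrArg (orbitMk K) hα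
  have hhq : h • q = q := by
    have e : h • n₀ • α = n₀⁻¹ • α := by
      rw [← hinv n₀ hn₀, mul_smul, mul_smul, hα]
    change orbitMk K (h • n₀ • α) = orbitMk K (n₀ • α)
    rw [e, orbitMk_eq_iff]
    exact ⟨(n₀ * n₀)⁻¹, K.inv_mem (hsqK n₀ hn₀), by rw [smul_smul]; group⟩
  have hker : ∀ k ∉ K, FixesAtMostTwo k (orbitRel.Quotient K Ω) := fun k hk =>
    fixesAtMostTwo_orbitRelQuotient hfix hsK hk
  -- Outside `K`, `h` cannot fix a third `K`-orbit, so it induces the transposition of `r` and `s`.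
  have hhr : h • r = s := by
    rcases hall (h • r) with e | e | e | e
    · exact absurd (MulAction.injective h (e.trans hhp.symm)) hpr.symm
    · exact absurd (MulAction.injective h (e.trans hhq.symm)) hqr.symm
    · rcases hker h (fun hk => hhN (hKN hk)) p q r hhp hhq e with e | e | e
      exacts [absurd e hpq, absurd e hpr, absurd e hqr]
    · exact e
  have hhs : h • s = r := by rw [← hhr, smul_smul, hh2, one_smul]
  have hggX : orbitMk N (g • g • α) = orbitMk N α := by
    refine eq_of_ne_of_card_two hX (z := orbitMk N (g • α)) (fun e => hgX ?_) hgX.symm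
    rw [← smul_orbitMk N g (g • α), ← smul_orbitMk N g α] at e
    exact (MulAction.injective g e)
  have hgr : g • r = p ∧ g • s = q ∨ g • r = q ∧ g • s = p := by
    have hgs : orbitMk N (g • g • n₀ • α) = orbitMk N α := by
      rw [← smul_orbitMk, hgn, smul_orbitMk, hggX]
    have hne : g • r ≠ g • s := fun e => hrs (MulAction.injective g e)
    have h1 : g • r = p ∨ g • r = q := by
      rcases hall (g • r) with e | e | e | e
      · exact Or.inl e
      · exact Or.inr e
      · exact absurd (hggX.symm.trans (hKtoN e)).symm hgX
      · exact absurd (hgn ▸ (hggX.symm.trans (hKtoN e)).symm) hgX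
    have h2 : g • s = p ∨ g • s = q := by
      rcases hall (g • s) with e | e | e | e
      · exact Or.inl e
      · exact Or.inr e
      · exact absurd (hgs.symm.trans (hKtoN e)).symm hgX
      · exact absurd (hgn ▸ (hgs.symm.trans (hKtoN e)).symm) hgX
    rcases h1 with h1 | h1 <;> rcases h2 with h2 | h2
    · exact absurd (h1.trans h2.symm) hne
    · exact Or.inl ⟨h1, h2⟩
    · exact Or.inr ⟨h1, h2⟩
    · exact absurd (h1.trans h2.symm) hne
  have hgp : g • p = r := rfl
  have hgq : g • q = s := rfl
  refine ⟨(doubleTranspositions _ hY).comap (toPermHom G _), inferInstance, ?_, ?_, ?_⟩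
  · intro d hd ω hω
    rw [mem_comap_doubleTranspositions] at hd
    have htriv := hd.resolve_right fun h' => (h' (orbitMk K ω)).1 (congrArg (orbitMk K) hω)
    refine hsK d ?_ ω hω
    by_contra hdK
    rcases hker d hdK p q r (htriv p) (htriv q) (htriv r) with e | e | e
    exacts [hpq e, hpr e, hqr e]
  · intro n hn
    rw [mem_comap_doubleTranspositions]
    by_cases hnK : n ∈ K
    · exact Or.inl (smul_orbitRelQuotient_of_mem K hnK)
    · exact Or.inr (hYN n hn hnK)
  · intro hle
    -- Either `g` is the double transposition `(p r)(q s)`, or `g` is a 4-cycle and `g * h` is that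
    -- double transposition. Both interchange the two `N`-orbits, so neither lies in `N`.
    rcases hgr with ⟨e1, e2⟩ | ⟨e1, e2⟩
    · refine hgX ?_
      rw [← smul_orbitMk]
      refine smul_orbitRelQuotient_of_mem N (hle ?_) _
      rw [mem_comap_doubleTranspositions]
      refine Or.inr fun y => ?_
      rcases hall y with rfl | rfl | rfl | rfl <;>
        simp [hgp, hgq, e1, e2, hpr, hqs, hpr.symm, hqs.symm]
    · refine hgX ?_
      rw [← smul_orbitMk]
      have : (g * h) • orbitMk N α = orbitMk N α :=
        smul_orbitRelQuotient_of_mem N (hle (by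
          rw [mem_comap_doubleTranspositions]
          refine Or.inr fun y => ?_
          rcases hall y with rfl | rfl | rfl | rfl <;>
            simp [mul_smul, hgp, hgq, hhp, hhq, hhr, hhs, e1, e2, hpr, hqs, hpr.symm,
              hqs.symm])) _
      rwa [mul_smul, hhx] at this

/-- A maximal semiregular normal subgroup with two orbits gives rise to a normal subgroup of
index two which acts as a Frobenius group on each of its two orbits. -/
theorem exists_frobenius_of_two_orbits [IsPretransitive G Ω] [FaithfulSMul G Ω]
    (hfix : ∀ g : G, g ≠ 1 → FixesAtMostTwo g Ω)
    (hs : N.ActsSemiregularly Ω) (hX : Nat.card (orbitRel.Quotient N Ω) = 2)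
    (hmax : ∀ R : Subgroup G, R.Normal → R.ActsSemiregularly Ω → N ≤ R → R ≤ N)
    (hstab : ∀ a : Ω, ∃ t : G, t ≠ 1 ∧ t • a = a) :
    ∃ F : Subgroup G, F.Normal ∧ F.index = 2 ∧
      Nat.card (orbitRel.Quotient F Ω) = 2 ∧
      (∀ a b : Ω, Nat.card (orbit F a) = Nat.card (orbit F b)) ∧
      ∀ a : Ω, IsFrobeniusAction F (orbit F a) := by
  have hXne : Nonempty (orbitRel.Quotient N Ω) := by
    by_contra hemp
    rw [not_nonempty_iff] at hemp
    simp at hX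
  obtain ⟨x₀⟩ := hXne
  have hF : ∀ g : G, g ∈ stabilizer G x₀ → ∀ x : orbitRel.Quotient N Ω, g • x = x :=
    fun g hg => smul_eq_of_card_two hX hg
  have hindex : (stabilizer G x₀).index = 2 := by rw [index_stabilizer_of_transitive, hX]
  have hFn : (stabilizer G x₀).Normal := Subgroup.normal_of_index_eq_two hindex
  have hmem : ∀ t : G, ∀ a : Ω, t • a = a → t ∈ stabilizer G x₀ := fun t a hta =>
    smul_eq_of_card_two hX (x := orbitMk N a) (congrArg (orbitMk N) hta) x₀
  have horb : ∀ a b : Ω, a ∈ orbit (stabilizer G x₀) b ↔ ∃ n ∈ N, n • b = a := by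
    intro a b
    constructor
    · rintro ⟨f, rfl⟩
      exact (orbitMk_eq_iff N).mp (hF f f.2 (orbitMk N b))
    · rintro ⟨n, hn, rfl⟩
      exact ⟨⟨n, smul_orbitRelQuotient_of_mem N hn x₀⟩, rfl⟩
  have hcard : ∀ a b : Ω,
      Nat.card (orbit (stabilizer G x₀) a) = Nat.card (orbit (stabilizer G x₀) b) := by
    intro a b
    obtain ⟨g, rfl⟩ := exists_smul_eq G a b
    rw [← smul_orbit_eq_orbit_smul, Nat.card_coe_set_eq, Nat.card_coe_set_eq, Set.ncard_smul_set]
  have hsub : ∀ a : Ω, ∀ g : stabilizer G x₀, g ≠ 1 →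
      (fixedBy (orbit (stabilizer G x₀) a) g).Subsingleton := by
    rintro a g hg u hu v hv
    by_contra huv
    have hu' : (g : G) • (u : Ω) = u := congrArg Subtype.val hu
    have hv' : (g : G) • (v : Ω) = v := congrArg Subtype.val hv
    obtain ⟨z, hz, hzu⟩ := (horb v u).mp
      ((orbit_eq_iff.mpr u.2).symm ▸ v.2)
    obtain ⟨R, hR, hRs, hNR, hRN⟩ := exists_semiregular_of_fixes_two_in_orbit hfix hs hX
      (fun e => hg (Subtype.ext e)) hu' hz
      (fun e => huv (Subtype.ext (by rw [← hzu, e, one_smul]))) (by rw [hzu, hv'])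
    exact hRN (hmax R hR hRs hNR)
  refine ⟨stabilizer G x₀, hFn, hindex, ?_, hcard, fun a => ⟨⟨?_⟩, inferInstance, ?_, hsub a⟩⟩
  · rw [← hX]
    refine Nat.card_congr (Quotient.congrRight fun a b => ?_)
    rw [orbitRel_apply, orbitRel_apply, horb]
    exact ⟨fun ⟨n, hn, h⟩ => ⟨⟨n, hn⟩, h⟩, fun ⟨n, h⟩ => ⟨n, n.2, h⟩⟩
  · intro g k hgk
    by_contra hne
    have hne' : k⁻¹ * g ≠ 1 := fun e => hne (inv_mul_eq_one.mp e).symm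
    have hall : ∀ u : orbit (stabilizer G x₀) a, (k⁻¹ * g) • u = u := fun u => by
      rw [mul_smul, hgk, inv_smul_smul]
    -- A nontrivial element acting trivially on one orbit would force that orbit, hence all of them,
    -- to be single points.
    have h1 : Nat.card (orbit (stabilizer G x₀) a) = 1 :=
      Nat.card_eq_one_iff_exists.mpr ⟨⟨a, mem_orbit_self a⟩, fun u =>
        hsub a _ hne' (hall u) (hall _)⟩
    refine hne' (Subtype.ext (FaithfulSMul.eq_of_smul_eq_smul (α := Ω) fun b => ?_))
    have h2 := (hcard b a).trans h1
    obtain ⟨c, hc⟩ := Nat.card_eq_one_iff_exists.mp h2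
    have h3 := (hc ⟨_, mem_orbit b (k⁻¹ * g)⟩).trans (hc ⟨b, mem_orbit_self b⟩).symm
    rw [OneMemClass.coe_one, one_smul]
    exact congrArg Subtype.val h3
  · obtain ⟨t, ht1, hta⟩ := hstab a
    refine ⟨⟨a, mem_orbit_self a⟩, fun hbot => ht1 ?_⟩
    have : (⟨t, hmem t a hta⟩ : stabilizer G x₀) ∈
        stabilizer (stabilizer G x₀) (⟨a, mem_orbit_self a⟩ : orbit (stabilizer G x₀) a) :=
      Subtype.ext hta
    rw [hbot, Subgroup.mem_bot] at this
    exact congrArg Subtype.val this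

end TwoOrbits

/-! ### Solubility and the division by number of orbits -/

/-- A proper normal subgroup of a soluble group lies strictly below a normal subgroup which is
abelian modulo it. -/
theorem exists_normal_lt_commutator_mem {G : Type*} [Group G] [Group.IsSolvable G]
    {N : Subgroup G} [N.Normal] (hN : N ≠ ⊤) :
    ∃ M : Subgroup G, M.Normal ∧ N ≤ M ∧ ¬ M ≤ N ∧
      ∀ a ∈ M, ∀ b ∈ M, a * b * a⁻¹ * b⁻¹ ∈ N := by
  classical
  have hex : ∃ n, derivedSeries (G ⧸ N) n = ⊥ :=
    (inferInstance : Group.IsSolvable (G ⧸ N)).solvable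
  have hspec := Nat.find_spec hex
  obtain ⟨k, hk⟩ : ∃ k, Nat.find hex = k + 1 := by
    refine Nat.exists_eq_succ_of_ne_zero fun h0 => hN ?_
    rw [h0, derivedSeries_zero] at hspec
    rw [eq_top_iff]
    intro g _
    have : (g : G ⧸ N) ∈ (⊤ : Subgroup (G ⧸ N)) := trivial
    rwa [hspec, Subgroup.mem_bot, QuotientGroup.eq_one_iff] at this
  rw [hk, derivedSeries_succ] at hspec
  -- `M` is the preimage of the last nontrivial term of the derived series of `G ⧸ N`.
  refine ⟨(derivedSeries (G ⧸ N) k).comap (QuotientGroup.mk' N), inferInstance, ?_, ?_, ?_⟩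
  · intro n hn
    rw [Subgroup.mem_comap, QuotientGroup.mk'_apply, (QuotientGroup.eq_one_iff n).mpr hn]
    exact Subgroup.one_mem _
  · intro hle
    refine Nat.find_min hex (m := k) (by omega) ((Subgroup.eq_bot_iff_forall _).mpr fun x hx => ?_)
    obtain ⟨g, rfl⟩ := QuotientGroup.mk_surjective x
    exact (QuotientGroup.eq_one_iff g).mpr (hle hx)
  · intro a ha b hb
    have ha' : QuotientGroup.mk' N a ∈ derivedSeries (G ⧸ N) k := ha
    have hb' : QuotientGroup.mk' N b ∈ derivedSeries (G ⧸ N) k := hb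
    have := Subgroup.commutator_mem_commutator ha' hb'
    rw [hspec, Subgroup.mem_bot] at this
    exact (QuotientGroup.eq_one_iff _).mp this

theorem HasFixity.fixesAtMostTwo {G Ω : Type*} [Group G] [MulAction G Ω] (h : HasFixity G Ω 2)
    (g : G) (hg : g ≠ 1) : FixesAtMostTwo g Ω := by
  intro a b c ha hb hc
  by_contra! hne
  have h2 : (fixedBy Ω g).encard ≤ 2 := h.2 ⟨g, hg, rfl⟩
  have h3 : ({a, b, c} : Set Ω).encard ≤ (fixedBy Ω g).encard := Set.encard_le_encard (by
    rintro x (rfl | rfl | rfl) <;> assumption)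
  rw [Set.encard_eq_three.mpr ⟨a, b, c, hne.1, hne.2.1, hne.2.2, rfl⟩] at h3
  exact absurd (h3.trans h2) (by decide)

theorem HasFixity.exists_smul_eq_self {G Ω : Type*} [Group G] [MulAction G Ω]
    [IsPretransitive G Ω] (h : HasFixity G Ω 2) (a : Ω) : ∃ t : G, t ≠ 1 ∧ t • a = a := by
  obtain ⟨t, ht, hcard⟩ := h.1
  obtain ⟨b, hb⟩ : (fixedBy Ω t).Nonempty := by
    rw [← Set.encard_ne_zero, ← hcard]
    decide
  obtain ⟨g, rfl⟩ := exists_smul_eq G b a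
  refine ⟨g * t * g⁻¹, by simpa using ht, ?_⟩
  rw [mul_smul, mul_smul, inv_smul_smul, (mem_fixedBy.mp hb : t • b = b)]

/-- A maximal semiregular normal subgroup of a soluble group with at least three orbits is
trivial, and the group is the alternating or symmetric group of degree four on six points. -/
theorem alternatingGroup_or_perm_of_three_orbits {G Ω : Type*} [Group G] [Finite G]
    [MulAction G Ω] [IsPretransitive G Ω] [Nonempty Ω] [Group.IsSolvable G]
    {N : Subgroup G} [N.Normal] (hfix : ∀ g : G, g ≠ 1 → FixesAtMostTwo g Ω)
    (hs : N.ActsSemiregularly Ω) {a b c : Ω} (hab : orbitMk N a ≠ orbitMk N b)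
    (hac : orbitMk N a ≠ orbitMk N c) (hbc : orbitMk N b ≠ orbitMk N c)
    (hmax : ∀ R : Subgroup G, R.Normal → R.ActsSemiregularly Ω → N ≤ R → R ≤ N) :
    (Nonempty (G ≃* alternatingGroup (Fin 4)) ∨ Nonempty (G ≃* Equiv.Perm (Fin 4))) ∧
      Nat.card Ω = 6 := by
  have hX : ∀ g ∉ N, FixesAtMostTwo g (orbitRel.Quotient N Ω) := fun g hg =>
    fixesAtMostTwo_orbitRelQuotient hfix hs hg
  have hker : ∀ g : G, (∀ x : orbitRel.Quotient N Ω, g • x = x) → g ∈ N := by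
    intro g hg
    by_contra hgN
    rcases hX g hgN _ _ _ (hg _) (hg _) (hg _) with e | e | e
    exacts [hab e, hac e, hbc e]
  have hNtop : N ≠ ⊤ := by
    rintro rfl
    obtain ⟨g, rfl⟩ := exists_smul_eq G a b
    exact hab ((orbitMk_eq_iff _).mpr ⟨g⁻¹, trivial, inv_smul_smul g a⟩)
  obtain ⟨M, hM, hNM, hMN, hcomm⟩ := exists_normal_lt_commutator_mem hNtop
  obtain ⟨t, htM, htN, ω, hω⟩ : ∃ t ∈ M, t ∉ N ∧ ∃ ω : Ω, t • ω = ω := by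
    by_contra! hall
    refine hMN (hmax M hM (fun m hm ω hω => ?_) hNM)
    by_contra hm1
    exact hall m hm (fun hmN => hm1 (hs m hmN ω hω)) ω hω
  obtain ⟨σ, hσ⟩ := exists_hasPairedOrbits (fun n hn => smul_orbitRelQuotient_of_mem N hn) hker hX
    hcomm ⟨t, htM, htN, orbitMk N ω, congrArg (orbitMk N) hω⟩
  obtain ⟨rfl, hM2⟩ := hσ.eq_bot_of_maximal hfix hs hNM hker hmax
  have hpt : ∀ m ∈ M, ∃ ω : Ω, m • ω = ω := fun m hm => by
    obtain ⟨x, hx⟩ := hσ.exists_fixed_of_maximal hs hNM hker hmax hm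
    obtain ⟨ω, rfl⟩ := orbitMk_surjective _ x
    rw [smul_orbitMk, orbitMk_eq_iff] at hx
    obtain ⟨n, hn, h⟩ := hx
    rw [Subgroup.mem_bot.mp hn, one_smul] at h
    exact ⟨ω, h.symm⟩
  have hab' : a ≠ b := fun e => hab (e ▸ rfl)
  have hac' : a ≠ c := fun e => hac (e ▸ rfl)
  have hbc' : b ≠ c := fun e => hbc (e ▸ rfl)
  -- With `N = ⊥` known, the pairing is rebuilt on `Ω` itself instead of on the orbits of `⊥`.
  obtain ⟨τ, hτ⟩ := exists_hasPairedOrbits (X := Ω) (N := ⊥) (M := M)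
    (by
      rintro n hn x
      rw [Subgroup.mem_bot.mp hn, one_smul])
    (fun g hg => by
      by_contra hg1
      rcases hfix g hg1 a b c (hg a) (hg b) (hg c) with e | e | e
      exacts [hab' e, hac' e, hbc' e])
    (fun g hg => hfix g hg) hcomm ⟨t, htM, htN, ω, hω⟩
  have hne : ∃ x y : Ω, y ≠ x ∧ y ≠ τ x := by
    by_cases hb : b = τ a
    · exact ⟨a, c, hac'.symm, fun e => hbc' (hb.trans e.symm)⟩
    · exact ⟨a, b, hab'.symm, hb⟩
  exact ⟨hτ.nonempty_mulEquiv hM2 hfix hpt hne, (hτ.card_eq_six hM2 hfix hpt hne).1⟩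

theorem theorem1p2 {G Ω : Type*} [Group G] [Finite G] [MulAction G Ω] [FaithfulSMul G Ω]
    [MulAction.IsPretransitive G Ω] (hsol : Group.IsSolvable G) (hfix : HasFixity G Ω 2) :
    (∃ N : Subgroup G, N.Normal ∧ IsRegularAction N Ω) ∨
    (∃ F : Subgroup G, F.Normal ∧ F.index = 2 ∧
      Nat.card (MulAction.orbitRel.Quotient F Ω) = 2 ∧
      (∀ a b : Ω, Nat.card (MulAction.orbit F a) = Nat.card (MulAction.orbit F b)) ∧
      ∀ a : Ω, IsFrobeniusAction F (MulAction.orbit F a)) ∨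
    ((Nonempty (G ≃* alternatingGroup (Fin 4)) ∨ Nonempty (G ≃* Equiv.Perm (Fin 4))) ∧
      Nat.card Ω = 6) := by
  have hfix2 := hfix.fixesAtMostTwo
  obtain ⟨α⟩ : Nonempty Ω := by
    obtain ⟨t, -, hcard⟩ := hfix.1
    have : (fixedBy Ω t).Nonempty := by
      rw [← Set.encard_ne_zero, ← hcard]
      decide
    exact this.to_type
  have hΩ : Finite Ω := Finite.of_surjective (fun g : G => g • α) (exists_smul_eq G α)
  obtain ⟨N, ⟨hN, hs⟩, hmax⟩ := (Set.toFinite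
    {N : Subgroup G | N.Normal ∧ N.ActsSemiregularly Ω}).exists_maximal
    ⟨⊥, inferInstance, fun n hn _ _ => Subgroup.mem_bot.mp hn⟩
  have hmax' : ∀ R : Subgroup G, R.Normal → R.ActsSemiregularly Ω → N ≤ R → R ≤ N :=
    fun R hR hRs hNR => hmax ⟨hR, hRs⟩ hNR
  have : Finite (orbitRel.Quotient N Ω) := Finite.of_surjective _ (orbitMk_surjective N)
  have := Fintype.ofFinite (orbitRel.Quotient N Ω)
  have hpos : 0 < Nat.card (orbitRel.Quotient N Ω) :=
    Nat.card_pos_iff.mpr ⟨⟨orbitMk N α⟩, inferInstance⟩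
  obtain h1 | h2 | h3 : Nat.card (orbitRel.Quotient N Ω) = 1 ∨
      Nat.card (orbitRel.Quotient N Ω) = 2 ∨ 2 < Nat.card (orbitRel.Quotient N Ω) := by omega
  · refine Or.inl ⟨N, hN, ⟨⟨fun a b => ?_⟩, fun a => ?_⟩⟩
    · obtain ⟨x, hx⟩ := Nat.card_eq_one_iff_exists.mp h1
      obtain ⟨n, hn, h⟩ := (orbitMk_eq_iff N).mp ((hx (orbitMk N b)).trans (hx (orbitMk N a)).symm)
      exact ⟨⟨n, hn⟩, h⟩
    · exact (Subgroup.eq_bot_iff_forall _).mpr fun n hn => Subtype.ext (hs n n.2 a hn)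
  · exact Or.inr (Or.inl (exists_frobenius_of_two_orbits hfix2 hs h2 hmax'
      hfix.exists_smul_eq_self))
  · rw [Nat.card_eq_fintype_card] at h3
    obtain ⟨x, y, z, hxy, hxz, hyz⟩ := Fintype.two_lt_card_iff.mp h3
    obtain ⟨a, rfl⟩ := orbitMk_surjective N x
    obtain ⟨b, rfl⟩ := orbitMk_surjective N y
    obtain ⟨c, rfl⟩ := orbitMk_surjective N z
    have : Nonempty Ω := ⟨α⟩
    exact Or.inr (Or.inr
      (alternatingGroup_or_perm_of_three_orbits hfix2 hs hxy hxz hyz hmax'))
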